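/- Let $a\le b$ be real numbers and $d$ a positive integer. Equip $\mathbb{R}^d$ with the Euclidean norm and $\mathbb{R}^{d\times d}$ with the associated operator norm $\|\cdot\|$, and for a function $f$ on an interval $I$ let $W_I(f)=\sup\sum_{i=1}^N\|f(x_i)-f(x_{i-1})\|$ (supremum over all $x_0<\dots<x_N$ in $I$) denote its total variation. For real functions $f$ of bounded variation and $u$ bounded and measurable on $[c,t)$, $\int_{[c,t)}u\,df$ is the Lebesgue–Stieltjes integral with respect to the finite signed Borel measure $\nu$ on $[c,t)$ generated by the restriction $f|_{[c,t)}$, that is $\nu(\{c\})=f(c^+)-f(c)$ and $\nu((u,v))=f(v^-)-f(u^+)$ for $c\le u<v\le t$; the integral is $0$ if $t\le c$. For matrix-valued $K$ and vector- or matrix-valued $R$, $\int_{[c,t)}dK(\tau)\,R(\tau)$ is defined entrywise by the rules of the matrix product. Measurable means Borel measurable. A Stieltjes–Volterra kernel of type $B^\infty$ on $[a,b]\times[a,b]$ is a measurable function $\kappa:[a,b]\times[a,b]\to\mathbb{R}^{d\times d}$ such that: $\kappa(t,\tau)=0$ for $\tau\ge t$; each $\kappa(t,\cdot)$ is left-continuous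 on $[a,b]$; $\sup_{t\in[a,b]}\bigl(W_{[a,b]}(\kappa(t,\cdot))+\|\kappa(t,a)\|\bigr)<\infty$; and for every $\varepsilon>0$ there is $\eta>0$ such that $W_{[\tau,t)}(\kappa(t,\cdot))<\varepsilon$ for all $t,\tau\in[a,b]$ with $0<t-\tau<\eta$. A resolvent for $\kappa$ is a Stieltjes–Volterra kernel $\rho$ of type $B^\infty$ on $[a,b]\times[a,b]$ with $$\rho(t,\beta)=-\kappa(t,\beta)+\int_{[\beta,t)}d\kappa(t,\tau)\,\rho(\tau,\beta),\qquad t,\beta\in[a,b],$$ where the differential is taken with respect to $\tau$. Let $\kappa$ be a Stieltjes–Volterra kernel of type $B^\infty$ on $[a,b]\times[a,b]$ and $\rho$ a resolvent for $\kappa$. Let $g:[a,b]\to\mathbb{R}^d$ be right-continuous and of bounded variation. Then the function $$y(t)=g(t)-\int_{[a,t)}d\rho(t,\alpha)\,g(\alpha),\qquad a\le t\le b,$$ is bounded and measurable and satisfies $$y(t)=\int_{[a,t)}d\kappa(t,\tau)\,y(\tau)+g(t),\qquad a\le t\le b,$$ and it is the only bounded measurable function $[a,b]\to\mathbb{R}^d$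 that satisfies this equation. -/

import Mathlib

open Set MeasureTheory
open scoped Matrix.Norms.L2Operator ENNReal

namespace StieltjesVolterra

noncomputable section

/-! ### The Lebesgue-Stieltjes integral over `[c, t)` -/

/-- The function that agrees with `f` on `[c, t]` and is constant on each side of `[c, t]`
(for `c ≤ t`). The Stieltjes measure of this function on `ℝ`, restricted to `[c, t)`, is the
Stieltjes measure of the restriction of `f` to `J = [c, t)`: it gives mass `f (c⁺) - f c` to `{c}`
and mass `f (v⁻) - f (u⁺)` to `(u, v)` for `c ≤ u < v ≤ t`; the values of `f` outside `[c, t)` play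
no role. -/
def freeze (f : ℝ → ℝ) (c t : ℝ) (x : ℝ) : ℝ := f (max c (min t x))

theorem boundedVariationOn_freeze {f : ℝ → ℝ} {c t : ℝ} (hct : c ≤ t)
    (hf : BoundedVariationOn f (Icc c t)) : BoundedVariationOn (freeze f c t) univ := by
  have hmono : MonotoneOn (fun x : ℝ => max c (min t x)) univ := by
    intro x _ y _ hxy
    exact max_le_max le_rfl (min_le_min le_rfl hxy)
  have hmaps : MapsTo (fun x : ℝ => max c (min t x)) univ (Icc c t) := by
    intro x _
    exact ⟨le_max_left _ _, max_le hct (min_le_left _ _)⟩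
  exact ne_top_of_le_ne_top hf (eVariationOn.comp_le_of_monotoneOn f _ hmono hmaps)

open Classical in
/-- The Lebesgue-Stieltjes integral `∫_{[c, t)} u df` with respect to the (signed) Stieltjes measure
of the restriction of `f` to `[c, t)`, for `f` of bounded variation; it is `0` if `t ≤ c`. -/
def integralIco (f u : ℝ → ℝ) (c t : ℝ) : ℝ :=
  if hf : BoundedVariationOn (freeze f c t) univ then
    ∫ᵛ x in Ico c t, u x ∂•hf.vectorMeasure
  else 0

/-- The vector `∫_{[c, t)} dK(τ) u(τ)`, with `i`-th entry `∑ j, ∫_{[c, t)} u_j dK_{ij}`. -/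
def integralVec {d : ℕ} (K : ℝ → Matrix (Fin d) (Fin d) ℝ) (u : ℝ → EuclideanSpace ℝ (Fin d))
    (c t : ℝ) : EuclideanSpace ℝ (Fin d) :=
  WithLp.toLp 2 fun i => ∑ j, integralIco (fun τ => K τ i j) (fun τ => u τ j) c t

/-- The matrix `∫_{[c, t)} dK(τ) R(τ)`, with `(i, l)` entry `∑ j, ∫_{[c, t)} R_{jl} dK_{ij}`. -/
def integralMat {d : ℕ} (K R : ℝ → Matrix (Fin d) (Fin d) ℝ) (c t : ℝ) :
    Matrix (Fin d) (Fin d) ℝ :=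
  Matrix.of fun i l => ∑ j, integralIco (fun τ => K τ i j) (fun τ => R τ j l) c t

/-! ### Stieltjes-Volterra kernels of type `B^∞`

Functions on `[a, b]` and on `[a, b] × [a, b]` are represented by functions on `ℝ` and on `ℝ × ℝ`
of which only the values on `[a, b]`, respectively `[a, b] × [a, b]`, are ever used. Matrices carry
the operator norm that comes from the Euclidean norm. -/

/-- `κ` is a Stieltjes-Volterra kernel of type `B^∞` on `[a, b] × [a, b]`. -/
structure IsKernel {d : ℕ} (a b : ℝ) (κ : ℝ → ℝ → Matrix (Fin d) (Fin d) ℝ) : Prop where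
  /-- `κ` is (Borel) measurable on `[a, b] × [a, b]`. -/
  measurable : ∀ i j, Measurable fun p : Icc a b × Icc a b => κ p.1 p.2 i j
  /-- `κ(t, τ) = 0` for `τ ≥ t`. -/
  eq_zero : ∀ t ∈ Icc a b, ∀ τ ∈ Icc a b, t ≤ τ → κ t τ = 0
  /-- Each `κ(t, ·)` is left-continuous on `[a, b]`. -/
  left_continuous : ∀ t ∈ Icc a b, ∀ τ ∈ Icc a b,
    ContinuousWithinAt (κ t) (Icc a b ∩ Iic τ) τ
  /-- The norms of `κ(t, ·)` in `BV([a, b])` are bounded uniformly in `t`. -/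
  bounded : ∃ C : ℝ, ∀ t ∈ Icc a b,
    eVariationOn (κ t) (Icc a b) + ENNReal.ofReal ‖κ t a‖ ≤ ENNReal.ofReal C
  /-- The variation of `κ(t, ·)` on `[τ, t)` tends to `0` as `τ → t⁻`, uniformly in `t`. -/
  uniform : ∀ ε : ℝ, 0 < ε → ∃ η : ℝ, 0 < η ∧ ∀ t ∈ Icc a b, ∀ τ ∈ Icc a b,
    0 < t - τ → t - τ < η → eVariationOn (κ t) (Ico τ t) < ENNReal.ofReal ε

/-- `ρ` is a resolvent for the kernel `κ` on `[a, b] × [a, b]`. -/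
structure IsResolvent {d : ℕ} (a b : ℝ) (κ ρ : ℝ → ℝ → Matrix (Fin d) (Fin d) ℝ) : Prop where
  isKernel : IsKernel a b ρ
  eq : ∀ t ∈ Icc a b, ∀ β ∈ Icc a b,
    ρ t β = -κ t β + integralMat (κ t) (fun τ => ρ τ β) β t

/-- `y` is a bounded (Borel) measurable solution on `[a, b]` of
`y(t) = ∫_{[a, t)} dκ(t, τ) y(τ) + g(t)`. -/
structure IsSolution {d : ℕ} (a b : ℝ) (κ : ℝ → ℝ → Matrix (Fin d) (Fin d) ℝ)
    (g y : ℝ → EuclideanSpace ℝ (Fin d)) : Prop where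
  measurable : Measurable fun t : Icc a b => y t
  bounded : ∃ C : ℝ, ∀ t ∈ Icc a b, ‖y t‖ ≤ C
  eq : ∀ t ∈ Icc a b, y t = integralVec (κ t) y a t + g t

end

end StieltjesVolterra

open Filter Topology

/-! Write `K` and `R` for the operators sending a bounded Borel function `u` to `t ↦ ∫_{[a,t)}
dκ(t,τ) u(τ)` and to the same integral with `ρ`. Existence rests on the operator identity `R = -K +
K R`: it gives `K(g - R g) + g = g - (-K g + K R g) = g - R g`.

The identity holds because the resolvent equation is exactly its value on indicators of `[β,∞)`.
Left-continuity and vanishing on the diagonal give `K 1_{[β,∞)}(t) = -κ(t,β)` for `β` in `[a,b]`,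
and likewise for `ρ`. Both sides are linear and respect bounded pointwise limits, so
`bounded_measurable_induction` extends the identity, together with Borel measurability of `R u`, to
every bounded Borel `u`. No interchange of two Stieltjes integrals is needed.

For uniqueness, the difference of two solutions is a bounded `z` with `z = K z`. Since `κ(t,·)` has
uniformly small variation on `[τ,t)` for `t - τ` small, `K` contracts on short strips once `z`
vanishes to their left; marching across `[a,b]` gives `z = 0`. Both halves use the bound of the
total mass of the Stieltjes measure by the variation on the half-open interval,
`variation_icoMeasure_le`. -/

namespace StieltjesVolterra

/-! ### ### Stieltjes measures on `[c, t)` and their total variation -/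

/-- Signed measures with the same values on all `[u, t)` with `c ≤ u < t` agree on `[c, t)`. -/
theorem restrict_Ico_eq_of_Ico {μ ν : SignedMeasure ℝ} {c t : ℝ}
    (h : ∀ u, c ≤ u → u < t → μ (Ico u t) = ν (Ico u t)) :
    μ.restrict (Ico c t) = ν.restrict (Ico c t) := by
  have key : ∀ u, c ≤ u → μ (Ico u t) = ν (Ico u t) := by
    intro u hu
    rcases lt_or_ge u t with hut | hut
    · exact h u hu hut
    · simp [Ico_eq_empty_of_le hut]
  refine VectorMeasure.ext_of_generateFrom (range Ici) ?_ ?_ isPiSystem_Ici ?_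
  · rintro _ ⟨u, rfl⟩
    have : Ici u ∩ Ico c t = Ico (max u c) t := by ext x; simp; tauto
    rw [VectorMeasure.restrict_apply _ measurableSet_Ico measurableSet_Ici,
      VectorMeasure.restrict_apply _ measurableSet_Ico measurableSet_Ici, this]
    exact key _ (le_max_right _ _)
  · rw [← borel_eq_generateFrom_Ici, BorelSpace.measurable_eq (α := ℝ)]
  · rw [VectorMeasure.restrict_apply _ measurableSet_Ico MeasurableSet.univ,
      VectorMeasure.restrict_apply _ measurableSet_Ico MeasurableSet.univ, univ_inter]
    exact key c le_rfl

open Classical in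
/-- The signed measure on `ℝ`, carried by `[c, t)`, generated by the restriction of `f` to
`[c, t)`. -/
noncomputable def icoMeasure (f : ℝ → ℝ) (c t : ℝ) : SignedMeasure ℝ :=
  if hf : BoundedVariationOn (freeze f c t) univ then hf.vectorMeasure.restrict (Ico c t) else 0

theorem icoMeasure_of_boundedVariationOn {f : ℝ → ℝ} {c t : ℝ}
    (hf : BoundedVariationOn (freeze f c t) univ) :
    icoMeasure f c t = hf.vectorMeasure.restrict (Ico c t) := by
  simp [icoMeasure, hf]

theorem integralIco_eq (f u : ℝ → ℝ) (c t : ℝ) :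
    integralIco f u c t = ∫ᵛ x, u x ∂•(icoMeasure f c t) := by
  unfold integralIco icoMeasure
  split_ifs <;> simp

theorem icoMeasure_restrict_self (f : ℝ → ℝ) (c t : ℝ) :
    (icoMeasure f c t).restrict (Ico c t) = icoMeasure f c t := by
  unfold icoMeasure
  split_ifs
  · rw [VectorMeasure.restrict_restrict _ measurableSet_Ico measurableSet_Ico, inter_self]
  · simp

theorem icoMeasure_of_le (f : ℝ → ℝ) {c t : ℝ} (h : t ≤ c) : icoMeasure f c t = 0 := by
  rw [← icoMeasure_restrict_self, Ico_eq_empty_of_le h, VectorMeasure.restrict_empty]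

theorem integral_icoMeasure_congr (f : ℝ → ℝ) {c t : ℝ} {u v : ℝ → ℝ} (h : EqOn u v (Ico c t)) :
    ∫ᵛ x, u x ∂•(icoMeasure f c t) = ∫ᵛ x, v x ∂•(icoMeasure f c t) := by
  rw [← icoMeasure_restrict_self]
  exact VectorMeasure.setIntegral_congr_fun h

/-- The left limit at `t` is approached from points of `[c,t)`, so a jump of `f` at `t` itself costs
nothing. -/
theorem leftLim_freeze_sub_le {f : ℝ → ℝ} {c t : ℝ} (hct : c < t)
    (hf : BoundedVariationOn (freeze f c t) univ) :
    ENNReal.ofReal |(freeze f c t).leftLim t - f c| ≤ eVariationOn f (Ico c t) := by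
  have h1 : Tendsto (fun x => ENNReal.ofReal |freeze f c t x - f c|) (𝓝[<] t)
      (𝓝 (ENNReal.ofReal |(freeze f c t).leftLim t - f c|)) :=
    ENNReal.tendsto_ofReal (((hf.tendsto_leftLim t).sub_const _).abs)
  refine le_of_tendsto h1 ?_
  filter_upwards [Ioo_mem_nhdsLT hct] with x hx
  have : freeze f c t x = f x := by simp [freeze, hx.1.le, hx.2.le]
  rw [this, ← Real.dist_eq, ← edist_dist]
  exact eVariationOn.edist_le f ⟨hx.1.le, hx.2⟩ ⟨le_rfl, hct⟩

theorem variationOnFromTo_freeze_left {f : ℝ → ℝ} {c t x : ℝ} (hct : c < t) (hx : x ≤ c) :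
    variationOnFromTo (freeze f c t) univ c x = 0 := by
  rw [variationOnFromTo.eq_of_ge _ _ hx, neg_eq_zero]
  have : eVariationOn (freeze f c t) (univ ∩ Icc x c) = 0 := by
    apply eVariationOn.constant_on
    rintro _ ⟨y, ⟨-, hy⟩, rfl⟩ _ ⟨z, ⟨-, hz⟩, rfl⟩
    have : ∀ y, y ≤ c → freeze f c t y = f c := fun y hy => by
      simp [freeze, hy.trans hct.le, hy]
    rw [this y hy.2, this z hz.2]
  rw [this, ENNReal.toReal_zero]

theorem variationOnFromTo_freeze_le {f : ℝ → ℝ} {c t x : ℝ} (hcx : c ≤ x) (hxt : x < t)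
    (hf : eVariationOn f (Ico c t) ≠ ∞) :
    variationOnFromTo (freeze f c t) univ c x ≤ (eVariationOn f (Ico c t)).toReal := by
  rw [variationOnFromTo.eq_of_le _ _ hcx, univ_inter]
  refine ENNReal.toReal_mono hf ?_
  have : EqOn (freeze f c t) f (Icc c x) := fun y hy => by
    simp [freeze, hy.1, hy.2.trans hxt.le]
  rw [eVariationOn.congr this]
  exact eVariationOn.mono _ fun y hy => ⟨hy.1, hy.2.trans_lt hxt⟩

/-- Write the frozen function as `h = V - (V - h)` with `V` its variation function based at `c`;
both parts are monotone, and their Stieltjes measures have mass at most `w` and `2w` on `[c,t)`,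
where `w` is the variation on `[c,t)`. The constant 3 is not sharp, but any constant would do. -/
theorem variation_icoMeasure_le (f : ℝ → ℝ) (c t : ℝ) :
    (icoMeasure f c t).variation univ ≤ 3 * eVariationOn f (Ico c t) := by
  rcases le_or_gt t c with hct | hct
  · simp [icoMeasure_of_le f hct]
  by_cases hf : BoundedVariationOn (freeze f c t) univ
  swap
  · simp [icoMeasure, hf]
  rcases eq_or_ne (eVariationOn f (Ico c t)) ∞ with htop | htop
  · simp [htop]
  rw [icoMeasure_of_boundedVariationOn hf]
  set h := freeze f c t with hh
  set w := (eVariationOn f (Ico c t)).toReal with hw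
  have hlb := hf.locallyBoundedVariationOn
  have hV : Monotone (variationOnFromTo h univ c) :=
    monotoneOn_univ.1 (variationOnFromTo.monotoneOn hlb (mem_univ c))
  have hQ : Monotone (variationOnFromTo h univ c - h) :=
    monotoneOn_univ.1 (variationOnFromTo.sub_self_monotoneOn hlb (mem_univ c))
  have hsub : ∀ x, Function.leftLim (variationOnFromTo h univ c - h) x
      = Function.leftLim (variationOnFromTo h univ c) x - h.leftLim x := fun x =>
    leftLim_eq_of_tendsto ((hV.tendsto_leftLim x).sub (hf.tendsto_leftLim x))
  -- A Stieltjes function is the right-continuous modification of a monotone function; this does not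
  -- change left limits.
  have hPl : ∀ x, Function.leftLim hV.stieltjesFunction x
      = Function.leftLim (variationOnFromTo h univ c) x := fun x =>
    leftLim_rightLim (hV.tendsto_leftLim x)
  have hQl : ∀ x, Function.leftLim hQ.stieltjesFunction x
      = Function.leftLim (variationOnFromTo h univ c - h) x := fun x =>
    leftLim_rightLim (hQ.tendsto_leftLim x)
  set P := hV.stieltjesFunction.measure
  set Q := hQ.stieltjesFunction.measure
  have hP : ∀ u, P (Ico u t) = ENNReal.ofReal (Function.leftLim (variationOnFromTo h univ c) t -
      Function.leftLim (variationOnFromTo h univ c) u) := fun u => by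
    rw [StieltjesFunction.measure_Ico, hPl, hPl]
  have hQ' : ∀ u, Q (Ico u t) = ENNReal.ofReal
      (Function.leftLim (variationOnFromTo h univ c - h) t -
      Function.leftLim (variationOnFromTo h univ c - h) u) := fun u => by
    rw [StieltjesFunction.measure_Ico, hQl, hQl]
  have hPfin : IsFiniteMeasure (P.restrict (Ico c t)) :=
    ⟨by rw [Measure.restrict_apply_univ, hP]; exact ENNReal.ofReal_lt_top⟩
  have hQfin : IsFiniteMeasure (Q.restrict (Ico c t)) :=
    ⟨by rw [Measure.restrict_apply_univ, hQ']; exact ENNReal.ofReal_lt_top⟩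
  have hVt : Function.leftLim (variationOnFromTo h univ c) t ≤ w := by
    refine le_of_tendsto (hV.tendsto_leftLim t) ?_
    filter_upwards [Ioo_mem_nhdsLT hct] with x hx
    exact variationOnFromTo_freeze_le hx.1.le hx.2 htop
  have hVc : Function.leftLim (variationOnFromTo h univ c) c = 0 := by
    refine leftLim_eq_of_tendsto (Tendsto.congr' ?_ tendsto_const_nhds)
    filter_upwards [self_mem_nhdsWithin] with x hx
    exact (variationOnFromTo_freeze_left hct (le_of_lt hx)).symm
  have hhc : h.leftLim c = f c := by
    refine leftLim_eq_of_tendsto (Tendsto.congr' ?_ tendsto_const_nhds)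
    filter_upwards [self_mem_nhdsWithin] with x (hx : x < c)
    simp [hh, freeze, hx.le, (hx.trans hct).le]
  have hdec : hf.vectorMeasure.restrict (Ico c t) =
      (P.restrict (Ico c t)).toSignedMeasure - (Q.restrict (Ico c t)).toSignedMeasure := by
    -- The difference is carried by `[c,t)`, so it equals its own restriction and the comparison on
    -- intervals `[u,t)` applies.
    have hself : ((P.restrict (Ico c t)).toSignedMeasure -
        (Q.restrict (Ico c t)).toSignedMeasure).restrict (Ico c t) =
        (P.restrict (Ico c t)).toSignedMeasure - (Q.restrict (Ico c t)).toSignedMeasure := by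
      ext s hs
      rw [VectorMeasure.restrict_apply _ measurableSet_Ico hs]
      simp [Measure.toSignedMeasure_apply, hs, hs.inter measurableSet_Ico, inter_assoc,
        measureReal_def, Measure.restrict_apply]
    rw [← hself]
    refine restrict_Ico_eq_of_Ico fun u hcu hut => ?_
    have hi : Ico u t ∩ Ico c t = Ico u t := inter_eq_left.2 (Ico_subset_Ico_left hcu)
    rw [hf.vectorMeasure_Ico hut.le, sub_apply,
      Measure.toSignedMeasure_apply_measurable measurableSet_Ico,
      Measure.toSignedMeasure_apply_measurable measurableSet_Ico, measureReal_def,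
      measureReal_def, Measure.restrict_apply measurableSet_Ico,
      Measure.restrict_apply measurableSet_Ico, hi, hP, hQ',
      ENNReal.toReal_ofReal (sub_nonneg.2 (hV.leftLim hut.le)),
      ENNReal.toReal_ofReal (sub_nonneg.2 (hQ.leftLim hut.le)), hsub, hsub]
    ring
  have hjump : |h.leftLim t - f c| ≤ w := by
    rw [← ENNReal.ofReal_le_iff_le_toReal htop]
    exact leftLim_freeze_sub_le hct hf
  rw [hdec]
  calc _ ≤ (P.restrict (Ico c t)) univ + (Q.restrict (Ico c t)) univ := by
        have := VectorMeasure.variation_sub_le (μ := (P.restrict (Ico c t)).toSignedMeasure)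
          (ν := (Q.restrict (Ico c t)).toSignedMeasure) univ
        simpa using this
    -- The second mass is `V(t⁻) - (h(t⁻) - f(c))`: one `w` bounds `V(t⁻)`, the other the increment
    -- of `h`.
    _ ≤ ENNReal.ofReal w + ENNReal.ofReal (2 * w) := by
        rw [Measure.restrict_apply_univ, Measure.restrict_apply_univ, hP, hQ', hsub, hsub, hVc,
          hhc]
        have := (abs_le.1 hjump).1
        gcongr
        · linarith
        · linarith
    _ = 3 * eVariationOn f (Ico c t) := by
        have hw0 : 0 ≤ w := ENNReal.toReal_nonneg
        rw [← ENNReal.ofReal_add hw0 (by positivity), ← ENNReal.ofReal_toReal htop, ← hw,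
          show (3 : ℝ≥0∞) = ENNReal.ofReal 3 by simp, ← ENNReal.ofReal_mul (by norm_num)]
        ring_nf

instance isFiniteMeasure_variation_icoMeasure (f : ℝ → ℝ) (c t : ℝ) :
    IsFiniteMeasure (icoMeasure f c t).variation := by
  rw [← SignedMeasure.totalVariation_eq_variation]
  exact ⟨by simp [SignedMeasure.totalVariation]⟩

theorem norm_integral_icoMeasure_le {f u : ℝ → ℝ} {c t M : ℝ}
    (hf : eVariationOn f (Ico c t) ≠ ∞) (hM : 0 ≤ M) (hu : ∀ x ∈ Ico c t, |u x| ≤ M) :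
    |∫ᵛ x, u x ∂•(icoMeasure f c t)| ≤ M * (3 * (eVariationOn f (Ico c t)).toReal) := by
  rw [← icoMeasure_restrict_self]
  have h1 := VectorMeasure.norm_setIntegral_le_of_norm_le_const (μ := icoMeasure f c t)
    (B := ContinuousLinearMap.lsmul ℝ ℝ) hu
  rw [Real.norm_eq_abs, mul_assoc] at h1
  refine h1.trans (mul_le_mul_of_nonneg_left ?_ hM)
  have h2 : ‖(ContinuousLinearMap.lsmul ℝ ℝ : ℝ →L[ℝ] ℝ →L[ℝ] ℝ)‖ ≤ 1 :=
    ContinuousLinearMap.opNorm_lsmul_le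
  have h3 : (icoMeasure f c t).variation.real (Ico c t) ≤
      3 * (eVariationOn f (Ico c t)).toReal := by
    have := ENNReal.toReal_mono (ENNReal.mul_ne_top (by simp) hf)
      ((measure_mono (subset_univ (Ico c t))).trans (variation_icoMeasure_le f c t))
    simpa [measureReal_def] using this
  calc _ ≤ 1 * (icoMeasure f c t).variation.real (Ico c t) := by gcongr
    _ ≤ _ := by rw [one_mul]; exact h3

/-! ### Left-continuous integrators -/

theorem continuousWithinAt_freeze {f : ℝ → ℝ} {a b c t : ℝ} (hac : a ≤ c) (hct : c ≤ t)
    (htb : t ≤ b)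
    (hf : ∀ τ ∈ Icc a b, ContinuousWithinAt f (Icc a b ∩ Iic τ) τ) (x : ℝ) :
    ContinuousWithinAt (freeze f c t) (Iic x) x := by
  have hmem : ∀ y, max c (min t y) ∈ Icc a b := fun y =>
    ⟨hac.trans (le_max_left _ _), (max_le hct (min_le_left _ _)).trans htb⟩
  have hcont : Continuous fun y : ℝ => max c (min t y) := by fun_prop
  refine ContinuousWithinAt.comp (hf _ (hmem x)) hcont.continuousWithinAt fun y hy => ⟨hmem y, ?_⟩
  exact max_le_max le_rfl (min_le_min le_rfl (mem_Iic.1 hy))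

theorem icoMeasure_Ico {f : ℝ → ℝ} {a b c t u : ℝ} (hac : a ≤ c) (hcu : c ≤ u) (hut : u ≤ t)
    (htb : t ≤ b) (hf : ∀ τ ∈ Icc a b, ContinuousWithinAt f (Icc a b ∩ Iic τ) τ)
    (hbv : BoundedVariationOn f (Icc a b)) :
    icoMeasure f c t (Ico u t) = f t - f u := by
  have hct := hcu.trans hut
  have hb := boundedVariationOn_freeze hct (hbv.mono (Icc_subset_Icc hac htb))
  have hl : ∀ x, (freeze f c t).leftLim x = freeze f c t x := fun x =>
    (continuousWithinAt_freeze hac hct htb hf x).leftLim_eq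
  rw [icoMeasure_of_boundedVariationOn hb,
    VectorMeasure.restrict_apply _ measurableSet_Ico measurableSet_Ico,
    inter_eq_left.2 (Ico_subset_Ico_left hcu), hb.vectorMeasure_Ico hut, hl, hl]
  simp [freeze, hut, hcu, hct]

/-- Both measures give `[u,t)` the mass `f t - f u`. Left-continuity matters: freezing at `c`
discards any jump `f(c) - f(c⁻)`, which the measure started at `a` would retain. -/
theorem icoMeasure_restrict {f : ℝ → ℝ} {a b c t : ℝ} (hac : a ≤ c) (htb : t ≤ b)
    (hf : ∀ τ ∈ Icc a b, ContinuousWithinAt f (Icc a b ∩ Iic τ) τ)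
    (hbv : BoundedVariationOn f (Icc a b)) :
    (icoMeasure f a t).restrict (Ico c t) = icoMeasure f c t := by
  rw [← icoMeasure_restrict_self f c t]
  refine restrict_Ico_eq_of_Ico fun u hcu hut => ?_
  rw [icoMeasure_Ico le_rfl (hac.trans hcu) hut.le htb hf hbv,
    icoMeasure_Ico hac hcu hut.le htb hf hbv]

theorem integral_icoMeasure_eq_of_eqOn_zero {f u : ℝ → ℝ} {a b c t : ℝ} (hac : a ≤ c)
    (htb : t ≤ b) (hf : ∀ τ ∈ Icc a b, ContinuousWithinAt f (Icc a b ∩ Iic τ) τ)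
    (hbv : BoundedVariationOn f (Icc a b)) (hu : ∀ x ∈ Ico a t, x < c → u x = 0) :
    ∫ᵛ x, u x ∂•(icoMeasure f a t) = ∫ᵛ x, u x ∂•(icoMeasure f c t) := by
  rw [← icoMeasure_restrict hac htb hf hbv, ← VectorMeasure.integral_indicator measurableSet_Ico]
  refine integral_icoMeasure_congr f fun x hx => ?_
  by_cases hxc : c ≤ x
  · rw [indicator_of_mem (show x ∈ Ico c t from ⟨hxc, hx.2⟩)]
  · rw [indicator_of_notMem (fun h => hxc h.1), hu x hx (not_le.1 hxc)]

variable {d : ℕ} {a b : ℝ} {κ ρ : ℝ → ℝ → Matrix (Fin d) (Fin d) ℝ}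

/-! ### A functional monotone class theorem -/

/-- A class of functions that contains the indicators of the half-lines `[β, ∞)` and is closed
under linear combinations and bounded pointwise limits contains all bounded Borel functions. -/
theorem bounded_measurable_induction {p : (ℝ → ℝ) → Prop}
    (indicator_Ici : ∀ β, p ((Ici β).indicator fun _ => 1))
    (add : ∀ u v, p u → p v → p fun x => u x + v x)
    (smul : ∀ (r : ℝ) u, p u → p fun x => r * u x)
    (lim : ∀ (u : ℕ → ℝ → ℝ) (v : ℝ → ℝ) (M : ℝ), (∀ n, p (u n)) → (∀ n x, |u n x| ≤ M) →
      (∀ x, Tendsto (fun n => u n x) atTop (𝓝 (v x))) → p v)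
    {u : ℝ → ℝ} (hu : Measurable u) {M : ℝ} (hM : ∀ x, |u x| ≤ M) : p u := by
  have zero : p fun _ => 0 := by simpa using smul 0 _ (indicator_Ici 0)
  have habs : ∀ (s : Set ℝ) (x : ℝ), |s.indicator (fun _ => (1 : ℝ)) x| ≤ 1 := by
    intro s x
    by_cases h : x ∈ s <;> simp [h]
  have one : p fun _ => 1 := by
    refine lim (fun n : ℕ => (Ici (-(n : ℝ))).indicator fun _ => 1) _ 1
      (fun n => indicator_Ici _) (fun n x => habs _ x) fun x => ?_
    refine tendsto_const_nhds.congr' ?_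
    obtain ⟨N, hN⟩ := exists_nat_ge (-x)
    filter_upwards [eventually_ge_atTop N] with n hn
    have : (N : ℝ) ≤ n := by exact_mod_cast hn
    rw [indicator_of_mem (show x ∈ Ici (-(n : ℝ)) by simp only [mem_Ici]; linarith)]
  have sets : ∀ s : Set ℝ, MeasurableSet s → p (s.indicator fun _ => 1) := by
    intro s hs
    have hgen : Real.measurableSpace = MeasurableSpace.generateFrom (range Ici) := by
      rw [← borel_eq_generateFrom_Ici, BorelSpace.measurable_eq (α := ℝ)]
    -- Dynkin's π-λ argument: complements come from `1 - 1_t`, disjoint unions from limits of finite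
    -- partial unions.
    induction s, hs using MeasurableSpace.induction_on_inter hgen (isPiSystem_Ici (α := ℝ)) with
    | empty => simpa using zero
    | basic t ht =>
      obtain ⟨β, rfl⟩ := ht
      exact indicator_Ici β
    | compl t _ iht =>
      convert! add _ _ one (smul (-1) _ iht) using 1
      ext x
      by_cases h : x ∈ t <;> simp [h]
    | iUnion f hfd _ ihf =>
      refine lim (fun n => (⋃ i ∈ Finset.range n, f i).indicator fun _ => 1) _ 1 (fun n => ?_)
        (fun n x => habs _ x) fun x => ?_
      · induction n with
        | zero => simpa using zero
        | succ n ih =>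
          convert! add _ _ ih (ihf n) using 1
          ext x
          have hd : Disjoint (⋃ i ∈ Finset.range n, f i) (f n) := by
            simp only [disjoint_iUnion_left]
            intro i hi
            exact hfd (Finset.mem_range.1 hi).ne
          rw [Finset.range_add_one, Finset.set_biUnion_insert, union_comm,
            indicator_union_of_disjoint hd]
      · refine tendsto_const_nhds.congr' ?_
        by_cases hx : ∃ i, x ∈ f i
        · obtain ⟨i, hi⟩ := hx
          filter_upwards [eventually_gt_atTop i] with n hn
          rw [indicator_of_mem (mem_iUnion.2 ⟨i, hi⟩), indicator_of_mem]
          exact mem_biUnion (Finset.mem_coe.2 (Finset.mem_range.2 hn)) hi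
        · filter_upwards with n
          rw [indicator_of_notMem (by simpa using hx), indicator_of_notMem]
          simp only [mem_iUnion, not_exists]
          exact fun i _ hi => hx ⟨i, hi⟩
  have simple : ∀ φ : SimpleFunc ℝ ℝ, p φ := by
    intro φ
    induction φ using SimpleFunc.induction with
    | const c hs =>
      convert! smul c _ (sets _ hs) using 1
      ext x
      simp [SimpleFunc.coe_piecewise, Set.piecewise, indicator]
    | add _ hf hg => exact add _ _ hf hg
  have hM0 : 0 ≤ M := (abs_nonneg _).trans (hM 0)
  -- The simple approximants are truncated at `M`, as the closure hypothesis asks for a uniform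
  -- bound.
  exact lim (fun n => hu.stronglyMeasurable.approxBounded M n) u M (fun n => simple _)
    (fun n x => hu.stronglyMeasurable.norm_approxBounded_le hM0 n x)
    fun x => hu.stronglyMeasurable.tendsto_approxBounded_of_norm_le (hM x)

theorem measurable_indicator_of_subtype {f : ℝ → ℝ} {s : Set ℝ} (hs : MeasurableSet s)
    (hf : Measurable fun x : s => f x) : Measurable (s.indicator f) := by
  refine measurable_of_restrict_of_restrict_compl hs ?_ ?_
  · convert! hf using 1
    ext x
    simp
  · convert! measurable_const (a := (0 : ℝ)) using 1
    ext x
    exact indicator_of_notMem x.2 f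

/-! ### Entries of kernels -/

/-- The entry is a coordinate of `A e_j`, and `e_j` is a unit vector. -/
theorem abs_entry_le (A : Matrix (Fin d) (Fin d) ℝ) (i j : Fin d) : |A i j| ≤ ‖A‖ := by
  have h := Matrix.l2_opNorm_mulVec A (EuclideanSpace.single j (1 : ℝ))
  have h2 := PiLp.norm_apply_le (WithLp.toLp 2 (A.mulVec (EuclideanSpace.single j (1 : ℝ)))) i
  simp only [PiLp.norm_single, norm_one, mul_one] at h
  simpa using h2.trans h

theorem lipschitzWith_entry (i j : Fin d) :
    LipschitzWith 1 fun A : Matrix (Fin d) (Fin d) ℝ => A i j :=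
  LipschitzWith.of_dist_le_mul fun A B => by
    rw [Real.dist_eq, dist_eq_norm, NNReal.coe_one, one_mul]
    exact abs_entry_le (A - B) i j

theorem eVariationOn_entry_le (f : ℝ → Matrix (Fin d) (Fin d) ℝ) (s : Set ℝ) (i j : Fin d) :
    eVariationOn (fun τ => f τ i j) s ≤ eVariationOn f s := by
  have h := ((lipschitzWith_entry i j).lipschitzOnWith (s := univ)).comp_eVariationOn_le
    (mapsTo_univ f s)
  rwa [ENNReal.coe_one, one_mul] at h

namespace IsKernel

theorem boundedVariationOn_entry (hκ : IsKernel a b κ) {t : ℝ} (ht : t ∈ Icc a b) (i j : Fin d) :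
    BoundedVariationOn (fun τ => κ t τ i j) (Icc a b) := by
  obtain ⟨C, hC⟩ := hκ.bounded
  have := (le_add_right le_rfl).trans (hC t ht)
  exact ne_top_of_le_ne_top ENNReal.ofReal_ne_top ((eVariationOn_entry_le _ _ i j).trans this)

theorem left_continuous_entry (hκ : IsKernel a b κ) {t : ℝ} (ht : t ∈ Icc a b) (i j : Fin d) :
    ∀ τ ∈ Icc a b, ContinuousWithinAt (fun τ => κ t τ i j) (Icc a b ∩ Iic τ) τ := fun τ hτ =>
  (lipschitzWith_entry i j).continuous.continuousAt.comp_continuousWithinAt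
    (hκ.left_continuous t ht τ hτ)

theorem exists_entry_bound (hκ : IsKernel a b κ) :
    ∃ C : ℝ, 0 ≤ C ∧ ∀ t ∈ Icc a b, ∀ (i j : Fin d),
      eVariationOn (fun τ => κ t τ i j) (Ico a t) ≤ ENNReal.ofReal C := by
  obtain ⟨C, hC⟩ := hκ.bounded
  refine ⟨max C 0, le_max_right _ _, fun t ht i j => ?_⟩
  calc _ ≤ eVariationOn (κ t) (Ico a t) := eVariationOn_entry_le _ _ i j
    _ ≤ eVariationOn (κ t) (Icc a b) :=
      eVariationOn.mono _ fun x hx => ⟨hx.1, hx.2.le.trans ht.2⟩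
    _ ≤ ENNReal.ofReal C := (le_add_right le_rfl).trans (hC t ht)
    _ ≤ _ := ENNReal.ofReal_le_ofReal (le_max_left _ _)

theorem measurable_section (hκ : IsKernel a b κ) {β : ℝ} (hβ : β ∈ Icc a b) (i j : Fin d) :
    Measurable ((Icc a b).indicator fun τ => κ τ β i j) := by
  exact measurable_indicator_of_subtype measurableSet_Icc ((hκ.measurable i j).comp
    (measurable_id.prodMk (measurable_const (a := (⟨β, hβ⟩ : Icc a b)))))

end IsKernel

/-! ### The integral operator of one entry of a kernel -/

/-- The function `t ↦ ∫_{[a, t)} u(τ) dκ_{ij}(t, τ)`. -/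
noncomputable def entryIntegral (a : ℝ) (κ : ℝ → ℝ → Matrix (Fin d) (Fin d) ℝ) (i j : Fin d)
    (u : ℝ → ℝ) (t : ℝ) : ℝ :=
  integralIco (fun τ => κ t τ i j) u a t

theorem integralVec_apply (κ : ℝ → ℝ → Matrix (Fin d) (Fin d) ℝ)
    (y : ℝ → EuclideanSpace ℝ (Fin d)) (a t : ℝ) (i : Fin d) :
    integralVec (κ t) y a t i = ∑ j, entryIntegral a κ i j (fun τ => y τ j) t := rfl

theorem entryIntegral_eq (a : ℝ) (κ : ℝ → ℝ → Matrix (Fin d) (Fin d) ℝ) (i j : Fin d)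
    (u : ℝ → ℝ) (t : ℝ) :
    entryIntegral a κ i j u t = ∫ᵛ x, u x ∂•(icoMeasure (fun τ => κ t τ i j) a t) :=
  integralIco_eq _ _ _ _

theorem entryIntegral_congr (κ : ℝ → ℝ → Matrix (Fin d) (Fin d) ℝ) (i j : Fin d)
    {u v : ℝ → ℝ} {t : ℝ} (h : EqOn u v (Ico a t)) :
    entryIntegral a κ i j u t = entryIntegral a κ i j v t := by
  simp only [entryIntegral_eq]
  exact integral_icoMeasure_congr _ h

theorem integrable_of_bounded {m : SignedMeasure ℝ} [IsFiniteMeasure m.variation] {u : ℝ → ℝ}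
    (hu : Measurable u) {M : ℝ} (hM : ∀ x, |u x| ≤ M) : VectorMeasure.Integrable m u :=
  Integrable.of_bound hu.aestronglyMeasurable M (ae_of_all _ hM)

theorem entryIntegral_add (i j : Fin d) {u v : ℝ → ℝ} {M N : ℝ} (hu : Measurable u)
    (hM : ∀ x, |u x| ≤ M) (hv : Measurable v) (hN : ∀ x, |v x| ≤ N) (t : ℝ) :
    entryIntegral a κ i j (fun x => u x + v x) t =
      entryIntegral a κ i j u t + entryIntegral a κ i j v t := by
  simp only [entryIntegral_eq]
  exact VectorMeasure.integral_fun_add (integrable_of_bounded hu hM) (integrable_of_bounded hv hN)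

theorem entryIntegral_mul (i j : Fin d) (r : ℝ) (u : ℝ → ℝ) (t : ℝ) :
    entryIntegral a κ i j (fun x => r * u x) t = r * entryIntegral a κ i j u t := by
  simp only [entryIntegral_eq]
  exact VectorMeasure.integral_fun_smul _ _ r u

theorem entryIntegral_sub (i j : Fin d) {u v : ℝ → ℝ} {M N : ℝ} (hu : Measurable u)
    (hM : ∀ x, |u x| ≤ M) (hv : Measurable v) (hN : ∀ x, |v x| ≤ N) (t : ℝ) :
    entryIntegral a κ i j (fun x => u x - v x) t =
      entryIntegral a κ i j u t - entryIntegral a κ i j v t := by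
  simp only [entryIntegral_eq]
  exact VectorMeasure.integral_fun_sub (integrable_of_bounded hu hM) (integrable_of_bounded hv hN)

theorem entryIntegral_sum {ι : Type*} (s : Finset ι) (i j : Fin d) {u : ι → ℝ → ℝ} {M : ℝ}
    (hu : ∀ k, Measurable (u k)) (hM : ∀ k x, |u k x| ≤ M) (t : ℝ) :
    entryIntegral a κ i j (fun x => ∑ k ∈ s, u k x) t =
      ∑ k ∈ s, entryIntegral a κ i j (u k) t := by
  simp only [entryIntegral_eq]
  exact VectorMeasure.integral_finsetSum s fun k _ => integrable_of_bounded (hu k) (hM k)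

theorem tendsto_entryIntegral (i j : Fin d) {u : ℕ → ℝ → ℝ} {v : ℝ → ℝ} {M : ℝ}
    (hu : ∀ n, Measurable (u n)) (hM : ∀ n x, |u n x| ≤ M)
    (hlim : ∀ x, Tendsto (fun n => u n x) atTop (𝓝 (v x))) (t : ℝ) :
    Tendsto (fun n => entryIntegral a κ i j (u n) t) atTop (𝓝 (entryIntegral a κ i j v t)) := by
  simp only [entryIntegral_eq]
  exact VectorMeasure.tendsto_integral_filter_of_norm_le_const
    (Eventually.of_forall fun n => (hu n).aestronglyMeasurable)
    ⟨M, Eventually.of_forall fun n => ae_of_all _ (hM n)⟩ (ae_of_all _ hlim)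

theorem IsKernel.exists_abs_entryIntegral_le (hκ : IsKernel a b κ) :
    ∃ C : ℝ, 0 ≤ C ∧ ∀ t ∈ Icc a b, ∀ (i j : Fin d) (u : ℝ → ℝ) (M : ℝ), 0 ≤ M →
      (∀ x ∈ Ico a t, |u x| ≤ M) → |entryIntegral a κ i j u t| ≤ M * C := by
  obtain ⟨C, hC0, hC⟩ := hκ.exists_entry_bound
  refine ⟨3 * C, by positivity, fun t ht i j u M hM hu => ?_⟩
  have hne := ne_top_of_le_ne_top ENNReal.ofReal_ne_top (hC t ht i j)
  rw [entryIntegral_eq]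
  refine (norm_integral_icoMeasure_le hne hM hu).trans ?_
  have := ENNReal.toReal_le_of_le_ofReal hC0 (hC t ht i j)
  gcongr

/-- The function `t ↦ ∫_{[a, t)} u(τ) dκ_{ij}(t, τ)` on `[a, b]`, extended by zero. -/
noncomputable def entryOp (a b : ℝ) (κ : ℝ → ℝ → Matrix (Fin d) (Fin d) ℝ) (i j : Fin d)
    (u : ℝ → ℝ) : ℝ → ℝ :=
  (Icc a b).indicator (entryIntegral a κ i j u)

theorem entryOp_of_mem (κ : ℝ → ℝ → Matrix (Fin d) (Fin d) ℝ) (i j : Fin d) (u : ℝ → ℝ) {t : ℝ}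
    (ht : t ∈ Icc a b) : entryOp a b κ i j u t = entryIntegral a κ i j u t :=
  indicator_of_mem ht _

theorem IsKernel.exists_abs_entryOp_le (hκ : IsKernel a b κ) :
    ∃ C : ℝ, 0 ≤ C ∧ ∀ (i j : Fin d) (u : ℝ → ℝ) (M : ℝ), (∀ x, |u x| ≤ M) →
      ∀ t, |entryOp a b κ i j u t| ≤ M * C := by
  obtain ⟨C, hC0, hC⟩ := hκ.exists_abs_entryIntegral_le
  refine ⟨C, hC0, fun i j u M hu t => ?_⟩
  have hM : 0 ≤ M := (abs_nonneg _).trans (hu 0)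
  by_cases ht : t ∈ Icc a b
  · rw [entryOp_of_mem κ i j u ht]
    exact hC t ht i j u M hM fun x _ => hu x
  · rw [entryOp, indicator_of_notMem ht, abs_zero]
    positivity

/-! ### The resolvent identity for integral operators -/

/-- With `β' = max β a`, the integral is the mass of `[β',t)`, namely `κ(t,t) - κ(t,β')`, and the
diagonal value is zero. If `t < β'`, both sides vanish. -/
theorem IsKernel.entryIntegral_indicator_Ici (hκ : IsKernel a b κ) {t : ℝ} (ht : t ∈ Icc a b)
    (i j : Fin d) (β : ℝ) (hβ : max β a ≤ b) :
    entryIntegral a κ i j ((Ici β).indicator fun _ => 1) t = -κ t (max β a) i j := by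
  have hi : Ici β ∩ Ico a t = Ico (max β a) t := by ext x; simp; tauto
  have hm : max β a ∈ Icc a b := ⟨le_max_right _ _, hβ⟩
  rw [entryIntegral_eq, VectorMeasure.integral_indicator_const _ measurableSet_Ici,
    ← icoMeasure_restrict_self, VectorMeasure.restrict_apply _ measurableSet_Ico measurableSet_Ici,
    hi]
  simp only [ContinuousLinearMap.lsmul_apply, one_smul]
  rcases le_or_gt (max β a) t with h | h
  · rw [icoMeasure_Ico le_rfl hm.1 h ht.2 (hκ.left_continuous_entry ht i j)
      (hκ.boundedVariationOn_entry ht i j), hκ.eq_zero t ht t ht le_rfl]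
    simp
  · rw [Ico_eq_empty_of_le h.le, hκ.eq_zero t ht _ hm h.le]
    simp

theorem entryIntegral_indicator_Ici_of_lt {t : ℝ} (i j : Fin d) {β : ℝ} (hβ : t ≤ max β a) :
    entryIntegral a κ i j ((Ici β).indicator fun _ => 1) t = 0 := by
  have : entryIntegral a κ i j ((Ici β).indicator fun _ => 1) t =
      entryIntegral a κ i j (fun _ => 0) t :=
    entryIntegral_congr κ i j fun x hx => indicator_of_notMem (fun h => by
      rcases le_max_iff.1 hβ with h' | h'
      · exact absurd (hx.2.trans_le h') (not_lt.2 h)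
      · exact absurd (hx.2.trans_le h') (not_lt.2 hx.1)) _
  rw [this, entryIntegral_eq, VectorMeasure.integral_zero]

/-- The operators `u ↦ ∫_{[a, t)} u dρ` and `u ↦ ∫_{[a, t)} u dκ`, acting on a bounded Borel
function `u`, satisfy the resolvent equation, and the former preserves measurability. -/
structure ResolventIdentity (a b : ℝ) (κ ρ : ℝ → ℝ → Matrix (Fin d) (Fin d) ℝ) (u : ℝ → ℝ) :
    Prop where
  measurable : Measurable u
  bounded : ∃ M : ℝ, ∀ x, |u x| ≤ M
  measurable_entryOp : ∀ j l, Measurable (entryOp a b ρ j l u)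
  eq : ∀ t ∈ Icc a b, ∀ i l, entryIntegral a ρ i l u t =
    -entryIntegral a κ i l u t + ∑ j, entryIntegral a κ i j (entryOp a b ρ j l u) t

namespace ResolventIdentity

theorem add (hρ : IsKernel a b ρ) {u v : ℝ → ℝ} (hu : ResolventIdentity a b κ ρ u)
    (hv : ResolventIdentity a b κ ρ v) : ResolventIdentity a b κ ρ fun x => u x + v x := by
  obtain ⟨M, hM⟩ := hu.bounded
  obtain ⟨N, hN⟩ := hv.bounded
  obtain ⟨C, -, hC⟩ := hρ.exists_abs_entryOp_le
  have hop : ∀ j l, entryOp a b ρ j l (fun x => u x + v x) =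
      fun t => entryOp a b ρ j l u t + entryOp a b ρ j l v t := fun j l => by
    ext t
    by_cases ht : t ∈ Icc a b
    · simp only [entryOp_of_mem _ _ _ _ ht]
      exact entryIntegral_add j l hu.measurable hM hv.measurable hN t
    · simp [entryOp, indicator_of_notMem ht]
  refine ⟨hu.measurable.add hv.measurable, ⟨M + N, fun x => (abs_add_le _ _).trans
    (add_le_add (hM x) (hN x))⟩, fun j l => ?_, fun t ht i l => ?_⟩
  · rw [hop]
    exact (hu.measurable_entryOp j l).add (hv.measurable_entryOp j l)
  · have h : ∀ j, entryIntegral a κ i j (entryOp a b ρ j l fun x => u x + v x) t =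
        entryIntegral a κ i j (entryOp a b ρ j l u) t +
        entryIntegral a κ i j (entryOp a b ρ j l v) t := fun j => by
      rw [hop]
      exact entryIntegral_add i j (hu.measurable_entryOp j l) (hC j l u M hM)
        (hv.measurable_entryOp j l) (hC j l v N hN) t
    simp only [h, Finset.sum_add_distrib]
    rw [entryIntegral_add i l hu.measurable hM hv.measurable hN,
      entryIntegral_add i l hu.measurable hM hv.measurable hN, hu.eq t ht, hv.eq t ht]
    ring

theorem mul (r : ℝ) {u : ℝ → ℝ} (hu : ResolventIdentity a b κ ρ u) :
    ResolventIdentity a b κ ρ fun x => r * u x := by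
  obtain ⟨M, hM⟩ := hu.bounded
  have hop : ∀ j l, entryOp a b ρ j l (fun x => r * u x) =
      fun t => r * entryOp a b ρ j l u t := fun j l => by
    ext t
    by_cases ht : t ∈ Icc a b
    · simp only [entryOp_of_mem _ _ _ _ ht, entryIntegral_mul]
    · simp [entryOp, indicator_of_notMem ht]
  refine ⟨hu.measurable.const_mul r, ⟨|r| * M, fun x => ?_⟩, fun j l => ?_, fun t ht i l => ?_⟩
  · rw [abs_mul]
    exact mul_le_mul_of_nonneg_left (hM x) (abs_nonneg r)
  · rw [hop]
    exact (hu.measurable_entryOp j l).const_mul r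
  · simp only [hop, entryIntegral_mul, ← Finset.mul_sum]
    rw [hu.eq t ht]
    ring

/-- Dominated convergence is used twice: first for the `ρ`-integrals of `u n`, which stay uniformly
bounded, then for the `κ`-integrals of the resulting functions. -/
theorem of_tendsto (hρ : IsKernel a b ρ) {u : ℕ → ℝ → ℝ} {v : ℝ → ℝ} {M : ℝ}
    (hu : ∀ n, ResolventIdentity a b κ ρ (u n)) (hM : ∀ n x, |u n x| ≤ M)
    (hlim : ∀ x, Tendsto (fun n => u n x) atTop (𝓝 (v x))) : ResolventIdentity a b κ ρ v := by
  obtain ⟨C, -, hC⟩ := hρ.exists_abs_entryOp_le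
  have hop : ∀ j l t, Tendsto (fun n => entryOp a b ρ j l (u n) t) atTop
      (𝓝 (entryOp a b ρ j l v t)) := fun j l t => by
    by_cases ht : t ∈ Icc a b
    · simp only [entryOp_of_mem _ _ _ _ ht]
      exact tendsto_entryIntegral j l (fun n => (hu n).measurable) hM hlim t
    · simp [entryOp, indicator_of_notMem ht]
  have hmeas := fun n => (hu n).measurable
  refine ⟨measurable_of_tendsto_metrizable hmeas (tendsto_pi_nhds.2 hlim),
    ⟨M, fun x => le_of_tendsto' (hlim x).abs fun n => hM n x⟩,
    fun j l => measurable_of_tendsto_metrizable (fun n => (hu n).measurable_entryOp j l)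
      (tendsto_pi_nhds.2 (hop j l)), fun t ht i l => ?_⟩
  refine tendsto_nhds_unique (tendsto_entryIntegral i l hmeas hM hlim t) ?_
  simp only [(hu _).eq t ht i l]
  exact (tendsto_entryIntegral i l hmeas hM hlim t).neg.add (tendsto_finsetSum _ fun j _ =>
    tendsto_entryIntegral i j (fun n => (hu n).measurable_entryOp j l)
      (fun n => hC j l (u n) M (hM n)) (hop j l) t)

theorem indicator_Ici (hκ : IsKernel a b κ) (hρ : IsResolvent a b κ ρ) (β : ℝ) :
    ResolventIdentity a b κ ρ ((Ici β).indicator fun _ => 1) := by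
  have hbd : ∀ x, |(Ici β).indicator (fun _ => (1 : ℝ)) x| ≤ 1 := by
    intro x
    by_cases h : x ∈ Ici β
    · rw [indicator_of_mem h, abs_one]
    · rw [indicator_of_notMem h, abs_zero]
      exact zero_le_one
  have hmeas : Measurable ((Ici β).indicator fun _ => (1 : ℝ)) :=
    measurable_const.indicator measurableSet_Ici
  rcases le_or_gt (max β a) b with hβ | hβ
  · have hm : max β a ∈ Icc a b := ⟨le_max_right _ _, hβ⟩
    have hop : ∀ j l, ∀ t ∈ Icc a b, entryOp a b ρ j l ((Ici β).indicator fun _ => 1) t =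
        -ρ t (max β a) j l := fun j l t ht => by
      rw [entryOp_of_mem _ _ _ _ ht, hρ.isKernel.entryIntegral_indicator_Ici ht j l β hβ]
    refine ⟨hmeas, ⟨1, hbd⟩, fun j l => ?_, fun t ht i l => ?_⟩
    · convert! (hρ.isKernel.measurable_section hm j l).neg using 1
      ext t
      by_cases ht : t ∈ Icc a b
      · rw [hop j l t ht, Pi.neg_apply, indicator_of_mem ht]
      · simp [entryOp, indicator_of_notMem ht]
    -- As `ρ(x,β') = 0` for `x ≤ β' = max β a`, the integral over `[a,t)` reduces to the one over
    -- `[β',t)` in the resolvent equation.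
    · have h : ∀ j, entryIntegral a κ i j (entryOp a b ρ j l ((Ici β).indicator fun _ => 1)) t =
          -integralIco (fun τ => κ t τ i j) (fun τ => ρ τ (max β a) j l) (max β a) t := fun j => by
        rw [entryIntegral_eq, integralIco_eq, integral_icoMeasure_eq_of_eqOn_zero hm.1 ht.2
          (hκ.left_continuous_entry ht i j) (hκ.boundedVariationOn_entry ht i j),
          ← VectorMeasure.integral_fun_neg]
        · exact integral_icoMeasure_congr _ fun x hx =>
            hop j l x ⟨hm.1.trans hx.1, hx.2.le.trans ht.2⟩
        · intro x hx hlt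
          have hx' : x ∈ Icc a b := ⟨hx.1, hx.2.le.trans ht.2⟩
          rw [hop j l x hx', hρ.isKernel.eq_zero x hx' _ hm hlt.le]
          simp
      have he := congrFun (congrFun (hρ.eq t ht _ hm) i) l
      simp only [Matrix.add_apply, Matrix.neg_apply, integralMat, Matrix.of_apply] at he
      simp only [h, Finset.sum_neg_distrib]
      rw [hρ.isKernel.entryIntegral_indicator_Ici ht i l β hβ,
        hκ.entryIntegral_indicator_Ici ht i l β hβ, he]
      ring
  -- Here `[β,∞)` misses every `[a,t)` with `t ≤ b`, so all terms are zero.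
  · have hop : ∀ j l, entryOp a b ρ j l ((Ici β).indicator fun _ => 1) = fun _ => 0 := by
      intro j l
      ext t
      by_cases ht : t ∈ Icc a b
      · rw [entryOp_of_mem _ _ _ _ ht, entryIntegral_indicator_Ici_of_lt j l (ht.2.trans hβ.le)]
      · rw [entryOp, indicator_of_notMem ht]
    refine ⟨hmeas, ⟨1, hbd⟩, fun j l => ?_, fun t ht i l => ?_⟩
    · rw [hop]
      exact measurable_const
    · simp only [hop]
      rw [entryIntegral_indicator_Ici_of_lt i l (ht.2.trans hβ.le),
        entryIntegral_indicator_Ici_of_lt i l (ht.2.trans hβ.le)]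
      simp [entryIntegral_eq]

theorem of_measurable (hκ : IsKernel a b κ) (hρ : IsResolvent a b κ ρ) {u : ℝ → ℝ}
    (hu : Measurable u) {M : ℝ} (hM : ∀ x, |u x| ≤ M) : ResolventIdentity a b κ ρ u :=
  bounded_measurable_induction (indicator_Ici hκ hρ) (fun _ _ => add hρ.isKernel)
    (fun r _ => mul r) (fun _ _ _ => of_tendsto hρ.isKernel) hu hM

end ResolventIdentity

/-! ### Existence -/

theorem abs_apply_le_norm (x : EuclideanSpace ℝ (Fin d)) (i : Fin d) : |x i| ≤ ‖x‖ := by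
  simpa using PiLp.norm_apply_le x i

theorem norm_le_sum_abs (x : EuclideanSpace ℝ (Fin d)) : ‖x‖ ≤ ∑ i, |x i| := by
  rw [EuclideanSpace.norm_eq]
  refine Real.sqrt_le_iff.2 ⟨Finset.sum_nonneg fun i _ => abs_nonneg _, ?_⟩
  simp only [Real.norm_eq_abs]
  exact Finset.sum_sq_le_sq_sum_of_nonneg fun i _ => abs_nonneg _

/-- A function of bounded variation on `[a, b]` agrees there with a bounded Borel function. -/
theorem exists_measurable_eqOn_of_boundedVariationOn (hab : a ≤ b) {f : ℝ → ℝ}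
    (hf : BoundedVariationOn f (Icc a b)) :
    ∃ u : ℝ → ℝ, Measurable u ∧ (∃ M, ∀ x, |u x| ≤ M) ∧ EqOn u f (Icc a b) := by
  have h := boundedVariationOn_freeze hab hf
  obtain ⟨p, q, hp, hq, hpq⟩ := h.locallyBoundedVariationOn.exists_monotoneOn_sub_monotoneOn
  refine ⟨freeze f a b, ?_, ⟨|freeze f a b a| + (eVariationOn (freeze f a b) univ).toReal,
    fun x => ?_⟩, fun x hx => by simp [freeze, hx.1, hx.2]⟩
  · rw [hpq]
    exact (monotoneOn_univ.1 hp).measurable.sub (monotoneOn_univ.1 hq).measurable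
  · have := h.dist_le (mem_univ x) (mem_univ a)
    rw [Real.dist_eq] at this
    have h2 := abs_sub_abs_le_abs_sub (freeze f a b x) (freeze f a b a)
    linarith

/-- The computation `K(g - R g) + g = g - R g`, entry by entry. The globally bounded Borel functions
`u l` stand in for the components of `g`, which are controlled only on `[a,b]`. -/
theorem isSolution_sub_integralVec (hκ : IsKernel a b κ) (hρ : IsResolvent a b κ ρ)
    {g : ℝ → EuclideanSpace ℝ (Fin d)} {u : Fin d → ℝ → ℝ} (hu : ∀ l, Measurable (u l)) {M : ℝ}
    (hM : ∀ l x, |u l x| ≤ M) (hgu : ∀ l, EqOn (u l) (fun x => g x l) (Icc a b)) :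
    IsSolution a b κ g fun t => g t - integralVec (ρ t) g a t := by
  have hR := fun l => ResolventIdentity.of_measurable hκ hρ (hu l) (hM l)
  obtain ⟨C, -, hC⟩ := hρ.isKernel.exists_abs_entryOp_le
  have hsub : ∀ {t}, t ∈ Icc a b → Ico a t ⊆ Icc a b :=
    fun ht x hx => ⟨hx.1, hx.2.le.trans ht.2⟩
  have hy : ∀ t ∈ Icc a b, ∀ i, (g t - integralVec (ρ t) g a t) i =
      u i t - ∑ l, entryOp a b ρ i l (u l) t := fun t ht i => by
    rw [PiLp.sub_apply, integralVec_apply, hgu i ht]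
    congr 1
    refine Finset.sum_congr rfl fun l _ => ?_
    rw [entryOp_of_mem _ _ _ _ ht]
    exact entryIntegral_congr ρ i l fun x hx => (hgu l (hsub ht hx)).symm
  have hS : ∀ j x, |∑ l, entryOp a b ρ j l (u l) x| ≤ ∑ _l : Fin d, M * C := fun j x =>
    (Finset.abs_sum_le_sum_abs _ _).trans (Finset.sum_le_sum fun l _ => hC j l (u l) M (hM l) x)
  have hSm : ∀ j, Measurable fun x => ∑ l, entryOp a b ρ j l (u l) x := fun j =>
    Finset.measurable_fun_sum _ fun l _ => (hR l).measurable_entryOp j l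
  refine ⟨?_, ⟨∑ _i : Fin d, (M + ∑ _l : Fin d, M * C), fun t ht => ?_⟩, fun t ht => ?_⟩
  · suffices h : Measurable fun t : Icc a b => (g t - integralVec (ρ t) g a t).ofLp from
      (MeasurableEquiv.toLp 2 (Fin d → ℝ)).measurable.comp h
    refine measurable_pi_iff.2 fun i => ?_
    have : Measurable fun t : Icc a b => u i t - ∑ l, entryOp a b ρ i l (u l) t :=
      ((hu i).sub (hSm i)).comp measurable_subtype_coe
    convert! this using 1
    ext t
    exact hy t t.2 i
  · refine (norm_le_sum_abs _).trans (Finset.sum_le_sum fun i _ => ?_)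
    rw [hy t ht i]
    exact (abs_sub _ _).trans (add_le_add (hM i t) (hS i t))
  · ext i
    have h1 : ∀ j, entryIntegral a κ i j (fun x => (g x - integralVec (ρ x) g a x) j) t =
        entryIntegral a κ i j (u j) t -
          ∑ l, entryIntegral a κ i j (entryOp a b ρ j l (u l)) t := fun j => by
      rw [entryIntegral_congr κ i j fun x hx => hy x (hsub ht hx) j,
        entryIntegral_sub i j (hu j) (hM j) (hSm j) (hS j),
        entryIntegral_sum _ i j (fun l => (hR l).measurable_entryOp j l)
          (fun l => hC j l (u l) M (hM l))]
    rw [hy t ht i, PiLp.add_apply, integralVec_apply]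
    simp only [h1, Finset.sum_sub_distrib]
    -- The resolvent identity has `l` fixed and sums over `j`, so the sum over `l` must be the outer
    -- one.
    rw [Finset.sum_comm (f := fun j l => entryIntegral a κ i j (entryOp a b ρ j l (u l)) t),
      show (g t).ofLp i = u i t from (hgu i ht).symm]
    simp only [entryOp_of_mem _ _ _ _ ht, (hR _).eq t ht, Finset.sum_add_distrib,
      Finset.sum_neg_distrib]
    ring

/-! ### Uniqueness -/

theorem IsKernel.exists_contraction (hκ : IsKernel a b κ) :
    ∃ η : ℝ, 0 < η ∧ ∀ s t, a ≤ s → s < t → t ≤ b → t - s < η →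
      ∀ (i : Fin d) (z : Fin d → ℝ → ℝ) (M : ℝ), 0 ≤ M →
      (∀ j, ∀ x ∈ Ico a t, x < s → z j x = 0) → (∀ j, ∀ x ∈ Ico s t, |z j x| ≤ M) →
      |∑ j, entryIntegral a κ i j (z j) t| ≤ M / 2 := by
  -- With `d` summands and the factor 3 of the mass bound, the total is `M * d / (2 * (d + 1)) ≤ M /
  -- 2`; using `d + 1` covers `d = 0`.
  obtain ⟨η, hη, h⟩ := hκ.uniform (1 / (6 * (d + 1))) (by positivity)
  refine ⟨η, hη, fun s t has hst htb hlt i z M hM hz hzM => ?_⟩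
  have ht : t ∈ Icc a b := ⟨has.trans hst.le, htb⟩
  have hv := h t ht s ⟨has, hst.le.trans htb⟩ (sub_pos.2 hst) hlt
  have hterm : ∀ j, |entryIntegral a κ i j (z j) t| ≤ M * (3 * (1 / (6 * (d + 1)))) := fun j => by
    have hve := (eVariationOn_entry_le (κ t) (Ico s t) i j).trans hv.le
    rw [entryIntegral_eq, integral_icoMeasure_eq_of_eqOn_zero has htb
      (hκ.left_continuous_entry ht i j) (hκ.boundedVariationOn_entry ht i j) (hz j)]
    refine (norm_integral_icoMeasure_le (ne_top_of_le_ne_top ENNReal.ofReal_ne_top hve) hM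
      (hzM j)).trans ?_
    have := ENNReal.toReal_le_of_le_ofReal (by positivity) hve
    gcongr
  refine (Finset.abs_sum_le_sum_abs _ _).trans ((Finset.sum_le_sum fun j _ => hterm j).trans ?_)
  rw [Finset.sum_const, Finset.card_univ, Fintype.card_fin, nsmul_eq_mul]
  have hd : (d : ℝ) * (3 * (1 / (6 * (d + 1)))) ≤ 1 / 2 := by
    rw [show (d : ℝ) * (3 * (1 / (6 * (d + 1)))) = d / (2 * (d + 1)) by field_simp; ring,
      div_le_div_iff₀ (by positivity) (by norm_num)]
    linarith
  calc (d : ℝ) * (M * (3 * (1 / (6 * (d + 1))))) = M * (d * (3 * (1 / (6 * (d + 1))))) := by ring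
    _ ≤ M * (1 / 2) := mul_le_mul_of_nonneg_left hd hM
    _ = M / 2 := by ring

/-- Outer induction marches over strips of length `η`; on each new strip, where `z` is known to
vanish to the left, an inner induction halves the bound on `z` indefinitely. -/
theorem IsKernel.eq_zero_of_homogeneous (hκ : IsKernel a b κ) {z : Fin d → ℝ → ℝ} {M : ℝ}
    (hM : ∀ i, ∀ t ∈ Icc a b, |z i t| ≤ M)
    (hz : ∀ i, ∀ t ∈ Icc a b, z i t = ∑ j, entryIntegral a κ i j (z j) t) :
    ∀ i, ∀ t ∈ Icc a b, z i t = 0 := by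
  obtain ⟨η, hη, h⟩ := hκ.exists_contraction
  have key : ∀ n : ℕ, ∀ i, ∀ t ∈ Icc a b, t < a + n * η → z i t = 0 := by
    intro n
    induction n with
    | zero => intro i t ht hlt; simp only [CharP.cast_eq_zero, zero_mul, add_zero] at hlt
              exact absurd ht.1 (not_le.2 hlt)
    | succ n ih =>
      have step : ∀ k : ℕ, ∀ i, ∀ t ∈ Icc a b, t < a + (n + 1 : ℕ) * η →
          |z i t| ≤ M / 2 ^ k := by
        intro k
        induction k with
        | zero => intro i t ht _; simpa using hM i t ht
        | succ k ihk =>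
          intro i t ht hlt
          have hM0 : 0 ≤ M := (abs_nonneg _).trans (hM i t ht)
          rcases lt_trichotomy t (a + n * η) with hlt' | heq | hgt
          · rw [ih i t ht hlt', abs_zero]
            positivity
          -- At the left end of the strip the contraction does not apply, as it needs `s < t`; but
          -- `z` vanishes on all of `[a,t)`.
          · rw [hz i t ht, Finset.sum_eq_zero, abs_zero]
            · positivity
            · intro j _
              rw [entryIntegral_congr κ i j (v := fun _ => 0) fun x hx =>
                ih j x ⟨hx.1, hx.2.le.trans ht.2⟩ (hx.2.trans_eq heq), entryIntegral_eq,
                VectorMeasure.integral_zero]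
          · rw [hz i t ht, pow_succ, ← div_div]
            have has : a ≤ a + n * η := le_add_of_nonneg_right (by positivity)
            refine h (a + n * η) t has hgt ht.2 ?_ i z _ (by positivity) ?_ ?_
            · push_cast at hlt
              linarith
            · exact fun j x hx hxs => ih j x ⟨hx.1, hx.2.le.trans ht.2⟩ hxs
            · exact fun j x hx => ihk j x ⟨has.trans hx.1, hx.2.le.trans ht.2⟩ (hx.2.trans hlt)
      intro i t ht hlt
      have hlim : Tendsto (fun k : ℕ => M / 2 ^ k) atTop (𝓝 0) := by
        have := (tendsto_pow_atTop_nhds_zero_of_lt_one (r := (1 / 2 : ℝ)) (by norm_num)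
          (by norm_num)).const_mul M
        simpa [div_eq_mul_inv] using this
      exact abs_nonpos_iff.1 (ge_of_tendsto' hlim fun k => step k i t ht hlt)
  intro i t ht
  obtain ⟨n, hn⟩ := exists_nat_gt ((t - a) / η)
  refine key n i t ht ?_
  rw [div_lt_iff₀ hη] at hn
  linarith

/-- The forcing term `g` cancels in the difference. Extension by zero outside `[a,b]` makes the
components bounded Borel on `ℝ`, so that linearity of the integral applies. -/
theorem IsSolution.eqOn (hκ : IsKernel a b κ) {g y w : ℝ → EuclideanSpace ℝ (Fin d)}
    (hy : IsSolution a b κ g y) (hw : IsSolution a b κ g w) : EqOn y w (Icc a b) := by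
  obtain ⟨M, hM⟩ := hy.bounded
  obtain ⟨N, hN⟩ := hw.bounded
  have hext : ∀ {y : ℝ → EuclideanSpace ℝ (Fin d)}, IsSolution a b κ g y → ∀ i,
      Measurable ((Icc a b).indicator fun t => y t i) := fun hy i =>
    measurable_indicator_of_subtype measurableSet_Icc
      ((PiLp.continuous_apply 2 _ i).measurable.comp hy.measurable)
  have hbd : ∀ {y : ℝ → EuclideanSpace ℝ (Fin d)} {M : ℝ}, (∀ t ∈ Icc a b, ‖y t‖ ≤ M) →
      ∀ i x, |(Icc a b).indicator (fun t => y t i) x| ≤ |M| := fun {y M} hM i x => by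
    by_cases hx : x ∈ Icc a b
    · rw [indicator_of_mem hx]
      exact (abs_apply_le_norm _ i).trans ((hM x hx).trans (le_abs_self M))
    · rw [indicator_of_notMem hx, abs_zero]
      exact abs_nonneg M
  have heq : ∀ {y : ℝ → EuclideanSpace ℝ (Fin d)}, IsSolution a b κ g y → ∀ i, ∀ t ∈ Icc a b,
      y t i = (∑ j, entryIntegral a κ i j ((Icc a b).indicator fun t => y t j) t) + g t i := by
    intro y hy i t ht
    conv_lhs => rw [hy.eq t ht, PiLp.add_apply, integralVec_apply]
    congr 1
    refine Finset.sum_congr rfl fun j _ => entryIntegral_congr κ i j fun x hx => ?_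
    rw [indicator_of_mem (show x ∈ Icc a b from ⟨hx.1, hx.2.le.trans ht.2⟩)]
  have h0 := hκ.eq_zero_of_homogeneous
    (z := fun i x => (Icc a b).indicator (fun t => y t i) x -
      (Icc a b).indicator (fun t => w t i) x) (M := |M| + |N|)
    (fun i t _ => (abs_sub _ _).trans (add_le_add (hbd hM i t) (hbd hN i t)))
    (fun i t ht => by
      simp only [entryIntegral_sub _ _ (hext hy _) (hbd hM _) (hext hw _) (hbd hN _),
        Finset.sum_sub_distrib, indicator_of_mem ht]
      rw [heq hy i t ht, heq hw i t ht]
      ring)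
  intro t ht
  ext i
  have := h0 i t ht
  simp only [indicator_of_mem ht] at this
  exact sub_eq_zero.1 this

end StieltjesVolterra

theorem lemma2 {d : ℕ} {a b : ℝ} (hab : a ≤ b)
    (κ ρ : ℝ → ℝ → Matrix (Fin d) (Fin d) ℝ)
    (hκ : StieltjesVolterra.IsKernel a b κ)
    (hρ : StieltjesVolterra.IsResolvent a b κ ρ)
    (g : ℝ → EuclideanSpace ℝ (Fin d))
    (hg_bv : BoundedVariationOn g (Icc a b))
    (hg_right : ∀ t ∈ Icc a b, ContinuousWithinAt g (Icc a b ∩ Ici t) t) :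
    StieltjesVolterra.IsSolution a b κ g
        (fun t => g t - StieltjesVolterra.integralVec (ρ t) g a t) ∧
      ∀ y : ℝ → EuclideanSpace ℝ (Fin d), StieltjesVolterra.IsSolution a b κ g y →
        ∀ t ∈ Icc a b, y t = g t - StieltjesVolterra.integralVec (ρ t) g a t := by
  have hlip : ∀ i : Fin d, LipschitzWith 1 fun x : EuclideanSpace ℝ (Fin d) => x i := fun i =>
    LipschitzWith.of_dist_le_mul fun x y => by
      rw [Real.dist_eq, dist_eq_norm, NNReal.coe_one, one_mul]
      exact StieltjesVolterra.abs_apply_le_norm (x - y) i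
  choose u hu hM hgu using fun i : Fin d =>
    StieltjesVolterra.exists_measurable_eqOn_of_boundedVariationOn hab
      ((hlip i).comp_boundedVariationOn hg_bv)
  choose M hM using hM
  -- The sum of the `|M i|` serves as a common bound for all components.
  have hsol := StieltjesVolterra.isSolution_sub_integralVec hκ hρ hu
    (fun l x => (hM l x).trans ((le_abs_self _).trans
      (Finset.single_le_sum (fun i _ => abs_nonneg (M i)) (Finset.mem_univ l)))) hgu
  exact ⟨hsol, fun y hy => hy.eqOn hκ hsol⟩
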